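/- Let $0<q<1$. For a complex polynomial $f$ let $\mathcal D_q f$ be the polynomial determined by $$(\mathcal D_q f)\Big(\tfrac{z+z^{-1}}2\Big)=\frac{\breve f(q^{1/2}z)-\breve f(q^{-1/2}z)}{\breve e(q^{1/2}z)-\breve e(q^{-1/2}z)},\qquad \breve f(z)=f\Big(\tfrac{z+z^{-1}}2\Big),\quad e(x)=x$$ (the Askey–Wilson operator). A sequence $(P_n)_{n\ge 0}$ of complex polynomials with $\deg P_n=n$ is an orthogonal polynomial sequence (OPS) with respect to a linear functional $\mathbf u$ on $\mathbb C[x]$ if $\langle\mathbf u,P_nP_m\rangle=\kappa_n\delta_{n,m}$ with $\kappa_n\in\mathbb C\setminus\{0\}$ for all $n,m\ge0$. Let $(P_n)_{n\ge0}$ be a monic OPS with respect to some linear functional, satisfying $$xP_n(x)=P_{n+1}(x)+B_nP_n(x)+C_nP_{n-1}(x)\quad(n\ge0),\qquad P_{-1}=0,$$ with complex coefficients $(B_n)_{n\ge0}$, $(C_n)_{n\ge1}$. Suppose that $(P_n)$ is classical with respect to $\mathcal D_q$, i.e. $(\mathcal D_qP_{n+1})_{n\ge0}$ is an OPS with respect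 to some linear functional. Then there are $\widehat a,\widehat b\in\mathbb C$ with $|\widehat a|+|\widehat b|\ne0$ such that the sequence $$r_n=\widehat a\,q^n+\widehat b\,q^{-n}\qquad(n\ge0)$$ is not identically zero and $$r_{n+3}B_{n+2}-(r_{n+2}+r_{n+1})B_{n+1}+r_nB_n=0\qquad(n\ge0),$$ $$r_n(B_n-qB_{n-1})(B_n-q^{-1}B_{n-1})=(r_{n+1}+r_{n+2})\big(C_{n+1}-\tfrac14\big)-4\alpha^2r_n\big(C_n-\tfrac14\big)+(r_{n-1}+r_{n-2})\big(C_{n-1}-\tfrac14\big)\qquad(n\ge2),$$ where $\alpha=\tfrac12(q^{1/2}+q^{-1/2})$. -/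

import Mathlib

namespace AskeyWilson

noncomputable section

open Polynomial

/-- The Joukowski map `z ↦ (z + 1/z)/2`. -/
def jouk (z : ℂ) : ℂ := (z + 1 / z) / 2

/-- The positive square root `q^{1/2}`, as a complex number. -/
def sqrtq (q : ℝ) : ℂ := ((Real.sqrt q : ℝ) : ℂ)

/-- `α = (q^{1/2} + q^{-1/2})/2`. -/
def alpha (q : ℝ) : ℂ := (sqrtq q + (sqrtq q)⁻¹) / 2

/-- `g` is the image of the polynomial `f` under the Askey-Wilson operator: with `x = (z + 1/z)/2`,
`g x = (f˘(q^{1/2} z) - f˘(q^{-1/2} z)) / (e˘(q^{1/2} z) - e˘(q^{-1/2} z))`, where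
`f˘ z = f ((z + 1/z)/2)` and `e x = x`, for all `z ≠ 0` at which the denominator is nonzero. -/
def IsAskeyWilsonImage (q : ℝ) (f g : ℂ[X]) : Prop :=
  ∀ z : ℂ, z ≠ 0 → jouk (sqrtq q * z) - jouk ((sqrtq q)⁻¹ * z) ≠ 0 →
    g.eval (jouk z) =
      (f.eval (jouk (sqrtq q * z)) - f.eval (jouk ((sqrtq q)⁻¹ * z))) /
        (jouk (sqrtq q * z) - jouk ((sqrtq q)⁻¹ * z))

/-- The Askey-Wilson operator `𝒟_q` on complex polynomials: the polynomial given by the defining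
divided difference (for `0 < q < 1` it exists and is unique, see `isAskeyWilsonImage_iff`). -/
def awD (q : ℝ) (f : ℂ[X]) : ℂ[X] := Classical.epsilon (IsAskeyWilsonImage q f)

theorem sqrtq_ne_zero {q : ℝ} (hq0 : 0 < q) : sqrtq q ≠ 0 := by
  unfold sqrtq
  exact_mod_cast (Real.sqrt_pos.2 hq0).ne'

theorem sqrtq_sq {q : ℝ} (hq0 : 0 < q) : sqrtq q ^ 2 = (q : ℂ) := by
  unfold sqrtq
  exact_mod_cast Real.sq_sqrt hq0.le

theorem jouk_sub {s z : ℂ} (hs : s ≠ 0) (hz : z ≠ 0) :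
    jouk (s * z) - jouk (s⁻¹ * z) = (s ^ 2 - 1) * (z ^ 2 - 1) / (2 * s * z) := by
  unfold jouk
  field_simp
  ring

theorem exists_pow_image {s : ℂ} (hs : s ≠ 0) (n : ℕ) : ∃ g h : ℂ[X], ∀ z : ℂ, z ≠ 0 →
    jouk (s * z) ^ n - jouk (s⁻¹ * z) ^ n
        = g.eval (jouk z) * (jouk (s * z) - jouk (s⁻¹ * z)) ∧
      jouk (s * z) ^ n + jouk (s⁻¹ * z) ^ n = 2 * h.eval (jouk z) := by
  induction n with
  | zero => exact ⟨0, 1, fun z _ => by norm_num⟩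
  | succ n ih =>
    obtain ⟨g, h, H⟩ := ih
    refine ⟨C ((s + s⁻¹) / 2) * X * g + h,
      C (((s + s⁻¹) / 2) ^ 2 - 1) * (X ^ 2 - 1) * g + C ((s + s⁻¹) / 2) * X * h, ?_⟩
    intro z hz
    obtain ⟨h1, h2⟩ := H z hz
    have e1 : jouk (s * z) + jouk (s⁻¹ * z) = (s + s⁻¹) * jouk z := by
      unfold jouk
      field_simp
      ring
    have e2 : (jouk (s * z) - jouk (s⁻¹ * z)) ^ 2
        = 4 * (((s + s⁻¹) / 2) ^ 2 - 1) * (jouk z ^ 2 - 1) := by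
      unfold jouk
      field_simp
      ring
    simp only [eval_add, eval_mul, eval_C, eval_X, eval_sub, eval_pow, eval_one]
    generalize jouk (s * z) = u at *
    generalize jouk (s⁻¹ * z) = w at *
    constructor
    · linear_combination ((u + w) / 2) * h1 + ((u - w) / 2) * h2
        + (eval (jouk z) g * (u - w) / 2) * e1
    · linear_combination ((u + w) / 2) * h2 + ((u - w) / 2) * h1
        + (eval (jouk z) h) * e1 + (eval (jouk z) g / 2) * e2

theorem exists_image {q : ℝ} (hq0 : 0 < q) (f : ℂ[X]) : ∃ g, IsAskeyWilsonImage q f g := by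
  have hs := sqrtq_ne_zero hq0
  suffices H : ∃ g : ℂ[X], ∀ z : ℂ, z ≠ 0 →
      f.eval (jouk (sqrtq q * z)) - f.eval (jouk ((sqrtq q)⁻¹ * z))
        = g.eval (jouk z) * (jouk (sqrtq q * z) - jouk ((sqrtq q)⁻¹ * z)) by
    obtain ⟨g, hg⟩ := H
    exact ⟨g, fun z hz hd => by rw [hg z hz, mul_div_cancel_right₀ _ hd]⟩
  induction f using Polynomial.induction_on' with
  | add f₁ f₂ h1 h2 =>
    obtain ⟨g₁, h1⟩ := h1
    obtain ⟨g₂, h2⟩ := h2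
    refine ⟨g₁ + g₂, fun z hz => ?_⟩
    simp only [eval_add]
    linear_combination h1 z hz + h2 z hz
  | monomial n a =>
    obtain ⟨g, h, H⟩ := exists_pow_image hs n
    refine ⟨C a * g, fun z hz => ?_⟩
    simp only [eval_monomial, eval_mul, eval_C]
    linear_combination a * (H z hz).1

theorem exists_jouk_eq (x : ℂ) : ∃ z : ℂ, z ≠ 0 ∧ jouk z = x := by
  obtain ⟨w, hw⟩ := IsAlgClosed.exists_pow_nat_eq (x ^ 2 - 1) (n := 2) (by norm_num)
  have hz : x + w ≠ 0 := by
    intro h0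
    have : (x + w) * (x - w) = 1 := by linear_combination -hw
    simp [h0] at this
  refine ⟨x + w, hz, ?_⟩
  unfold jouk
  field_simp
  linear_combination hw

theorem image_unique {q : ℝ} (hq0 : 0 < q) (hq1 : q < 1) {f g₁ g₂ : ℂ[X]}
    (h1 : IsAskeyWilsonImage q f g₁) (h2 : IsAskeyWilsonImage q f g₂) : g₁ = g₂ := by
  have hs := sqrtq_ne_zero hq0
  refine Polynomial.eq_of_infinite_eval_eq g₁ g₂ (Set.Infinite.mono ?_
    (Set.Finite.infinite_compl (Set.toFinite ({1, -1} : Set ℂ))))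
  intro x hx
  obtain ⟨z, hz, rfl⟩ := exists_jouk_eq x
  have hd : jouk (sqrtq q * z) - jouk ((sqrtq q)⁻¹ * z) ≠ 0 := by
    rw [jouk_sub hs hz, sqrtq_sq hq0]
    have hq : (q : ℂ) - 1 ≠ 0 := by
      rw [sub_ne_zero]
      exact_mod_cast hq1.ne
    have hz2 : z ^ 2 - 1 ≠ 0 := by
      intro h0
      apply hx
      have h3 : (z - 1) * (z + 1) = 0 := by linear_combination h0
      rcases mul_eq_zero.1 h3 with h | h
      · left
        rw [sub_eq_zero.1 h]
        norm_num [jouk]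
      · right
        rw [eq_neg_of_add_eq_zero_left h]
        norm_num [jouk]
    exact div_ne_zero (mul_ne_zero hq hz2) (mul_ne_zero (mul_ne_zero two_ne_zero hs) hz)
  show g₁.eval _ = g₂.eval _
  rw [h1 z hz hd, h2 z hz hd]

theorem awD_spec {q : ℝ} (hq0 : 0 < q) (f : ℂ[X]) : IsAskeyWilsonImage q f (awD q f) :=
  Classical.epsilon_spec (exists_image hq0 f)

/-- For `0 < q < 1`, `awD q f` is the one and only polynomial given by the divided difference. -/
theorem isAskeyWilsonImage_iff {q : ℝ} (hq0 : 0 < q) (hq1 : q < 1) (f g : ℂ[X]) :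
    IsAskeyWilsonImage q f g ↔ g = awD q f :=
  ⟨fun h => image_unique hq0 hq1 h (awD_spec hq0 f), fun h => h ▸ awD_spec hq0 f⟩

/-- `(P_n)` is an orthogonal polynomial sequence with respect to the linear functional `u`:
`deg P_n = n` and `⟨u, P_n P_m⟩ = κ_n δ_{n,m}` with `κ_n ≠ 0`. -/
structure IsOPS (P : ℕ → ℂ[X]) (u : Module.Dual ℂ ℂ[X]) : Prop where
  degree_eq : ∀ n, (P n).degree = n
  orthogonal : ∀ n m, n ≠ m → u (P n * P m) = 0
  norm_ne_zero : ∀ n, u (P n * P n) ≠ 0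

/-- A monic OPS with respect to `u`. -/
structure IsMonicOPS (P : ℕ → ℂ[X]) (u : Module.Dual ℂ ℂ[X]) : Prop extends IsOPS P u where
  monic : ∀ n, (P n).Monic

/-- The three term recurrence relation
`x P_n = P_{n+1} + B_n P_n + C_n P_{n-1}` for `n ≥ 0`, with `P_{-1} = 0`.
The value `c 0` plays no role. -/
structure IsTTRR (P : ℕ → ℂ[X]) (B c : ℕ → ℂ) : Prop where
  zero : X * P 0 = P 1 + C (B 0) * P 0
  succ : ∀ n, X * P (n + 1) = P (n + 2) + C (B (n + 1)) * P (n + 1) + C (c (n + 1)) * P n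

/-- `(P_n)` is classical with respect to the Askey-Wilson operator: `(𝒟_q P_{n+1})_{n ≥ 0}` is
an OPS with respect to some linear functional. -/
def IsClassical (q : ℝ) (P : ℕ → ℂ[X]) : Prop :=
  ∃ v : Module.Dual ℂ ℂ[X], IsOPS (fun n => awD q (P (n + 1))) v

end

end AskeyWilson

namespace AskeyWilson

open Polynomial

/-! The engine is the product rule `awD_X_mul_X_mul`. Applied to `P n`, with three-term recurrences
for both `P n` and `R n = awD q (P n)`, it becomes an identity in the basis `R (k + 1)`; comparing
coefficients (`coeff_identities`) gives a nonlinear system for `B`, `c` and the recurrence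
coefficients `a`, `b`, `d` of the derivatives. With `τ = 2 * alpha q`, both `a` and the quotients `d
(n + 1) / c (n + 2)` satisfy Riccati equations, linearised by solutions `g`, `S` of `x (n + 2) = τ *
x (n + 1) - x n`. Two relations then become linear in `B`, `b` and a third quadratic; eliminating
`b` leaves coefficients that the addition formula `chebSeq_succ_mul_sub` collapses to terms of `S`.
The required sequence is `r n = S (2 * n)`: the characteristic roots are `q^{1/2}` and `q^{-1/2}`,
so even indices give powers of `q`. -/

/-! ### Algebra of the Askey–Wilson operator -/

theorem awD_eq_of_mul {q : ℝ} (hq0 : 0 < q) (hq1 : q < 1) {f g : ℂ[X]}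
    (h : ∀ z : ℂ, z ≠ 0 → f.eval (jouk (sqrtq q * z)) - f.eval (jouk ((sqrtq q)⁻¹ * z))
      = g.eval (jouk z) * (jouk (sqrtq q * z) - jouk ((sqrtq q)⁻¹ * z))) : awD q f = g :=
  ((isAskeyWilsonImage_iff hq0 hq1 f g).1 fun z hz hd => by
    rw [h z hz, mul_div_cancel_right₀ _ hd]).symm

theorem awD_mul_spec {q : ℝ} (hq0 : 0 < q) (f : ℂ[X]) {z : ℂ} (hz : z ≠ 0) :
    f.eval (jouk (sqrtq q * z)) - f.eval (jouk ((sqrtq q)⁻¹ * z))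
      = (awD q f).eval (jouk z) * (jouk (sqrtq q * z) - jouk ((sqrtq q)⁻¹ * z)) := by
  by_cases hd : jouk (sqrtq q * z) - jouk ((sqrtq q)⁻¹ * z) = 0
  · rw [sub_eq_zero.1 hd]
    ring
  · rw [awD_spec hq0 f z hz hd, div_mul_cancel₀ _ hd]

theorem awD_C {q : ℝ} (hq0 : 0 < q) (hq1 : q < 1) (a : ℂ) : awD q (C a) = 0 :=
  awD_eq_of_mul hq0 hq1 fun z _ => by simp

theorem awD_add {q : ℝ} (hq0 : 0 < q) (hq1 : q < 1) (f g : ℂ[X]) :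
    awD q (f + g) = awD q f + awD q g :=
  awD_eq_of_mul hq0 hq1 fun z hz => by
    simp only [eval_add]
    linear_combination awD_mul_spec hq0 f hz + awD_mul_spec hq0 g hz

theorem awD_C_mul {q : ℝ} (hq0 : 0 < q) (hq1 : q < 1) (a : ℂ) (f : ℂ[X]) :
    awD q (C a * f) = C a * awD q f :=
  awD_eq_of_mul hq0 hq1 fun z hz => by
    simp only [eval_mul, eval_C]
    linear_combination a * awD_mul_spec hq0 f hz

/-- The second order product rule of the Askey-Wilson operator for multiplication by `x`. -/
theorem awD_X_mul_X_mul {q : ℝ} (hq0 : 0 < q) (hq1 : q < 1) (f : ℂ[X]) :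
    awD q (X * (X * f)) = C (2 * alpha q) * (X * awD q (X * f)) - X * (X * awD q f)
      - C (alpha q ^ 2 - 1) * awD q f := by
  refine awD_eq_of_mul hq0 hq1 fun z hz => ?_
  have hs := sqrtq_ne_zero hq0
  have h1 := awD_mul_spec hq0 f hz
  have h2 := awD_mul_spec hq0 (X * f) hz
  -- The sum and product of the two nodes are polynomials in `jouk z`, so each node `t` satisfies a
  -- quadratic that reduces `t ^ 2 * f t`.
  have e1 : jouk (sqrtq q * z) + jouk ((sqrtq q)⁻¹ * z) = 2 * alpha q * jouk z := by
    unfold jouk alpha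
    field_simp
    ring
  have e2 : jouk (sqrtq q * z) * jouk ((sqrtq q)⁻¹ * z) = jouk z ^ 2 + alpha q ^ 2 - 1 := by
    unfold jouk alpha
    field_simp
    ring
  simp only [eval_mul, eval_X, eval_sub, eval_C] at h2 ⊢
  generalize jouk (sqrtq q * z) = u at *
  generalize jouk ((sqrtq q)⁻¹ * z) = w at *
  linear_combination (u * eval u f - w * eval w f) * e1 - (eval u f - eval w f) * e2
    + 2 * alpha q * jouk z * h2 - (jouk z ^ 2 + alpha q ^ 2 - 1) * h1

/-! ### Orthogonal sequences: expansions, dual functionals, recurrences -/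

namespace IsOPS

variable {P : ℕ → ℂ[X]} {u : Module.Dual ℂ ℂ[X]}

theorem exists_eq_sum (h : IsOPS P u) (n : ℕ) (f : ℂ[X]) (hf : f.degree < n) :
    ∃ c : ℕ → ℂ, f = ∑ i ∈ Finset.range n, C (c i) * P i := by
  induction n generalizing f with
  | zero =>
    refine ⟨0, ?_⟩
    rw [Finset.range_zero, Finset.sum_empty, ← degree_eq_bot]
    exact Nat.WithBot.lt_zero_iff.1 hf
  | succ n ih =>
    have hPn : (P n).coeff n ≠ 0 := coeff_ne_zero_of_eq_degree (h.degree_eq n)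
    obtain ⟨c, hc⟩ := ih (f - C (f.coeff n / (P n).coeff n) * P n) (by
      rw [degree_lt_iff_coeff_zero] at hf ⊢
      intro m hm
      rw [coeff_sub, coeff_C_mul]
      rcases hm.eq_or_lt with rfl | hm
      · field_simp
        ring
      · rw [hf m hm, coeff_eq_zero_of_degree_lt (n := m) ((h.degree_eq n).trans_lt (by exact_mod_cast hm))]
        ring)
    refine ⟨fun i => if i = n then f.coeff n / (P n).coeff n else c i, ?_⟩
    rw [Finset.sum_range_succ]
    dsimp only
    rw [if_pos rfl, ← sub_eq_iff_eq_add, hc]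
    exact Finset.sum_congr rfl fun i hi => by rw [if_neg (Finset.mem_range.1 hi).ne]

theorem apply_C_mul (u : Module.Dual ℂ ℂ[X]) (a : ℂ) (f : ℂ[X]) : u (C a * f) = a * u f := by
  rw [← smul_eq_C_mul, map_smul, smul_eq_mul]

theorem apply_sum_mul (h : IsOPS P u) (n j : ℕ) (c : ℕ → ℂ) :
    u ((∑ i ∈ Finset.range n, C (c i) * P i) * P j)
      = if j < n then c j * u (P j * P j) else 0 := by
  rw [Finset.sum_mul, map_sum]
  have : ∀ i ∈ Finset.range n, u (C (c i) * P i * P j)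
      = if i = j then c j * u (P j * P j) else 0 := fun i _ => by
    rw [mul_assoc, apply_C_mul]
    split_ifs with hij
    · rw [hij]
    · rw [h.orthogonal i j hij, mul_zero]
  rw [Finset.sum_congr rfl this, Finset.sum_ite_eq']
  simp

theorem apply_mul_eq_zero (h : IsOPS P u) {n : ℕ} {f : ℂ[X]} (hf : f.degree < n) :
    u (f * P n) = 0 := by
  obtain ⟨c, rfl⟩ := h.exists_eq_sum n f hf
  rw [h.apply_sum_mul, if_neg (lt_irrefl _)]

/-- Every orthogonal polynomial sequence has dual functionals. -/
theorem exists_dual (h : IsOPS P u) (j : ℕ) :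
    ∃ φ : Module.Dual ℂ ℂ[X], ∀ i, φ (P i) = if i = j then 1 else 0 := by
  refine ⟨(u (P j * P j))⁻¹ • u ∘ₗ LinearMap.mulRight ℂ (P j), fun i => ?_⟩
  simp only [LinearMap.smul_apply, LinearMap.comp_apply, LinearMap.mulRight_apply, smul_eq_mul]
  split_ifs with hij
  · rw [hij, inv_mul_cancel₀ (h.norm_ne_zero j)]
  · rw [h.orthogonal i j hij, mul_zero]

/-- Every orthogonal polynomial sequence satisfies a three term recurrence relation. -/
theorem exists_recurrence (h : IsOPS P u) : ∃ a b c : ℕ → ℂ,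
    X * P 0 = C (a 0) * P 1 + C (b 0) * P 0 ∧
    ∀ n, X * P (n + 1) = C (a (n + 1)) * P (n + 2) + C (b (n + 1)) * P (n + 1)
      + C (c (n + 1)) * P n := by
  have hdeg : ∀ n, (X * P n).degree < ((n + 2 : ℕ) : WithBot ℕ) := fun n => by
    rw [degree_mul, degree_X, h.degree_eq]
    exact_mod_cast (by omega : 1 + n < n + 2)
  choose c hc using fun n => h.exists_eq_sum (n + 2) (X * P n) (hdeg n)
  refine ⟨fun n => c n (n + 1), fun n => c n n, fun n => c n (n - 1), ?_, fun n => ?_⟩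
  · rw [hc 0, Finset.sum_range_succ, Finset.sum_range_succ, Finset.sum_range_zero]
    ring
  · have hz : ∀ i ∈ Finset.range n, C (c (n + 1) i) * P i = 0 := fun i hi => by
      have hi := Finset.mem_range.1 hi
      have h1 := h.apply_sum_mul (n + 1 + 2) i (c (n + 1))
      rw [← hc, if_pos (by omega), show X * P (n + 1) * P i = X * P i * P (n + 1) by ring,
        h.apply_mul_eq_zero ((hdeg i).trans_le (by exact_mod_cast (by omega : i + 2 ≤ n + 1)))] at h1
      rw [(mul_eq_zero.1 h1.symm).resolve_right (h.norm_ne_zero i), C_0, zero_mul]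
    rw [hc (n + 1), Finset.sum_range_succ, Finset.sum_range_succ, Finset.sum_range_succ,
      Finset.sum_eq_zero hz]
    simp only [Nat.add_sub_cancel]
    ring

/-- Evaluating `u (X * P n * P (n + 1))` through either recurrence gives `c (n + 1) * u (P n * P n)
= u (P (n + 1) * P (n + 1))`. -/
theorem recurrence_coeff_ne_zero (h : IsOPS P u) {B c : ℕ → ℂ} (hT : IsTTRR P B c) (n : ℕ) :
    c (n + 1) ≠ 0 := by
  intro h0
  have h1 : u (X * P (n + 1) * P n) = 0 := by
    rw [hT.succ, h0, C_0, zero_mul, add_zero, add_mul, map_add, mul_assoc, apply_C_mul,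
      h.orthogonal _ _ (by omega), h.orthogonal _ _ (by omega), mul_zero, add_zero]
  have h2 : u (X * P n * P (n + 1)) = u (P (n + 1) * P (n + 1)) := by
    cases n with
    | zero =>
      rw [hT.zero, add_mul, map_add, mul_assoc, apply_C_mul, h.orthogonal 0 1 (by omega)]
      simp
    | succ n =>
      rw [hT.succ, add_mul, add_mul, map_add, map_add, mul_assoc, mul_assoc, apply_C_mul,
        apply_C_mul, h.orthogonal (n + 1) _ (by omega), h.orthogonal n _ (by omega)]
      simp
  apply h.norm_ne_zero (n + 1)
  rw [← h2, ← h1]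
  congr 1
  ring

end IsOPS

/-! ### Comparison of coefficients -/

/-- The coefficient identities obtained by expanding `𝒟_q (x ^ 2 P_n)` in the basis
`(𝒟_q P_{k+1})`; `a`, `b`, `d` are the recurrence coefficients of `(𝒟_q P_{k+1})`. -/
theorem coeff_identities {q : ℝ} (hq0 : 0 < q) (hq1 : q < 1) {P : ℕ → ℂ[X]}
    {v : Module.Dual ℂ ℂ[X]} {B c : ℕ → ℂ} (hdeg : (P 0).degree = 0) (hT : IsTTRR P B c)
    (hv : IsOPS (fun n => awD q (P (n + 1))) v) : ∃ a b d : ℕ → ℂ,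
    2 * alpha q * a 0 = 1 ∧
    2 * alpha q * b 0 = B 1 + B 0 ∧
    (∀ n, a (n + 1) * (2 * alpha q - a n) = 1) ∧
    (∀ n, B (n + 2) + B (n + 1) = 2 * alpha q * (b (n + 1) + B (n + 1) * a n)
      - a n * (b (n + 1) + b n)) ∧
    (c 2 + B 1 ^ 2 + c 1 = 2 * alpha q * (d 1 + B 1 * b 0) - a 0 * d 1 - b 0 ^ 2
      - (alpha q ^ 2 - 1)) ∧
    (∀ n, c (n + 3) + B (n + 2) ^ 2 + c (n + 2)
      = 2 * alpha q * (d (n + 2) + B (n + 2) * b (n + 1) + c (n + 2) * a n)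
        - a (n + 1) * d (n + 2) - b (n + 1) ^ 2 - d (n + 1) * a n - (alpha q ^ 2 - 1)) ∧
    (∀ n, c (n + 2) * (B (n + 2) + B (n + 1)) = 2 * alpha q * (B (n + 2) * d (n + 1)
      + c (n + 2) * b n) - d (n + 1) * (b (n + 1) + b n)) ∧
    (∀ n, c (n + 3) * c (n + 2) = 2 * alpha q * c (n + 3) * d (n + 1) - d (n + 2) * d (n + 1)) := by
  obtain ⟨a, b, d, h0, h1⟩ := hv.exists_recurrence
  set R : ℕ → ℂ[X] := fun n => awD q (P n) with hR
  have hR0 : R 0 = 0 := by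
    rw [hR]
    dsimp only
    rw [eq_C_of_degree_eq_zero hdeg, awD_C hq0 hq1]
  have h0 : X * R 1 = C (a 0) * R 2 + C (b 0) * R 1 := h0
  have h1 : ∀ n, X * R (n + 2) = C (a (n + 1)) * R (n + 3) + C (b (n + 1)) * R (n + 2)
    + C (d (n + 1)) * R (n + 1) := h1
  choose φ hφ using hv.exists_dual
  have hφ : ∀ j i, φ j (R i) = if i = j + 1 then 1 else 0 := by
    rintro j (_ | i)
    · simp [hR0]
    · simpa using hφ j i
  have dz : awD q (X * P 0) = R 1 := by
    rw [hT.zero, awD_add hq0 hq1, awD_C_mul hq0 hq1, show awD q (P 0) = 0 from hR0, mul_zero,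
      add_zero]
  have ds : ∀ n, awD q (X * P (n + 1)) = R (n + 2) + C (B (n + 1)) * R (n + 1)
      + C (c (n + 1)) * R n := fun n => by
    rw [hT.succ, awD_add hq0 hq1, awD_add hq0 hq1, awD_C_mul hq0 hq1, awD_C_mul hq0 hq1]
  have key := fun n => awD_X_mul_X_mul hq0 hq1 (P n)
  have k0 : R 2 + (B 1 + B 0) • R 1 = (2 * alpha q) • (a 0 • R 2 + b 0 • R 1) := by
    have := key 0
    rw [dz, hT.zero, mul_add, awD_add hq0 hq1, show X * (C (B 0) * P 0) = C (B 0) * (X * P 0) by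
      ring, awD_C_mul hq0 hq1, dz, ds 0, show awD q (P 0) = 0 from hR0, h0, hR0] at this
    simp only [smul_eq_C_mul, C_add]
    linear_combination this
  have k1 : R 3 + (B 2 + B 1) • R 2 + (c 2 + B 1 ^ 2 + c 1) • R 1
      = (2 * alpha q) • (a 1 • R 3 + b 1 • R 2 + d 1 • R 1 + B 1 • (a 0 • R 2 + b 0 • R 1))
        - (a 0 • (a 1 • R 3 + b 1 • R 2 + d 1 • R 1) + b 0 • (a 0 • R 2 + b 0 • R 1))
        - (alpha q ^ 2 - 1) • R 1 := by
    have := key 1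
    rw [ds 0, hT.succ 0, mul_add, mul_add, awD_add hq0 hq1, awD_add hq0 hq1,
      show X * (C (B (0 + 1)) * P (0 + 1)) = C (B 1) * (X * P (0 + 1)) by ring,
      show X * (C (c (0 + 1)) * P 0) = C (c 1) * (X * P 0) by ring,
      awD_C_mul hq0 hq1, awD_C_mul hq0 hq1, dz, ds 0, ds 1, hR0,
      show awD q (P 1) = R 1 from rfl, h0] at this
    have e := h1 0
    simp only [zero_add, Nat.reduceAdd] at this e
    simp only [smul_eq_C_mul, C_add, C_pow]
    linear_combination this + (C (2 * alpha q) - C (a 0)) * e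
      + (C (2 * alpha q) * C (B 1) - C (b 0)) * h0
  -- The value `d 0` is immaterial, since it multiplies `R 0 = 0`.
  have h2 : ∀ n, X * R (n + 1) = C (a n) * R (n + 2) + C (b n) * R (n + 1) + C (d n) * R n := by
    rintro (_ | n)
    · rw [hR0, mul_zero, add_zero, zero_add, h0]
    · exact h1 n
  have k2 : ∀ n, R (n + 4) + (B (n + 3) + B (n + 2)) • R (n + 3)
      + (c (n + 3) + B (n + 2) ^ 2 + c (n + 2)) • R (n + 2)
      + (c (n + 2) * (B (n + 2) + B (n + 1))) • R (n + 1) + (c (n + 2) * c (n + 1)) • R n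
      = (2 * alpha q) • (a (n + 2) • R (n + 4) + b (n + 2) • R (n + 3) + d (n + 2) • R (n + 2)
          + B (n + 2) • (a (n + 1) • R (n + 3) + b (n + 1) • R (n + 2) + d (n + 1) • R (n + 1))
          + c (n + 2) • (a n • R (n + 2) + b n • R (n + 1) + d n • R n))
        - (a (n + 1) • (a (n + 2) • R (n + 4) + b (n + 2) • R (n + 3) + d (n + 2) • R (n + 2))
          + b (n + 1) • (a (n + 1) • R (n + 3) + b (n + 1) • R (n + 2) + d (n + 1) • R (n + 1))
          + d (n + 1) • (a n • R (n + 2) + b n • R (n + 1) + d n • R n))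
        - (alpha q ^ 2 - 1) • R (n + 2) := by
    intro n
    have := key (n + 2)
    rw [ds (n + 1), hT.succ (n + 1), mul_add, mul_add, awD_add hq0 hq1, awD_add hq0 hq1,
      show X * (C (B (n + 2)) * P (n + 2)) = C (B (n + 2)) * (X * P (n + 2)) by ring,
      show X * (C (c (n + 2)) * P (n + 1)) = C (c (n + 2)) * (X * P (n + 1)) by ring,
      awD_C_mul hq0 hq1, awD_C_mul hq0 hq1, ds n, ds (n + 1), ds (n + 2),
      show awD q (P (n + 2)) = R (n + 2) from rfl] at this
    have e0 := h2 n
    have e1 := h2 (n + 1)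
    have e2 := h2 (n + 2)
    simp only [add_assoc, Nat.reduceAdd] at this e0 e1 e2
    simp only [smul_eq_C_mul, C_add, C_mul, C_pow]
    simp only [C_mul] at this
    linear_combination this + (C 2 * C (alpha q) - C (a (n + 1))) * e2
      + (C 2 * C (alpha q) * C (B (n + 2)) - C (b (n + 1)) - X) * e1
      + (C 2 * C (alpha q) * C (c (n + 2)) - C (d (n + 1))) * e0
  -- Each identity is one coefficient: `φ j` reads off that of `R (j + 1)`.
  refine ⟨a, b, d, ?_, ?_, ?_, ?_, ?_, fun n => ?_, fun n => ?_, fun n => ?_⟩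
  · have := congrArg (φ 1) k0
    simp [hφ] at this
    linear_combination -this
  · have := congrArg (φ 0) k0
    simp [hφ] at this
    linear_combination -this
  · rintro (_ | n)
    · have := congrArg (φ 2) k1
      simp [hφ, add_assoc] at this
      linear_combination -this
    · have := congrArg (φ (n + 3)) (k2 n)
      simp [hφ, add_assoc] at this
      linear_combination -this
  · rintro (_ | n)
    · have := congrArg (φ 1) k1
      simp [hφ, add_assoc] at this
      linear_combination this
    · have := congrArg (φ (n + 2)) (k2 n)
      simp [hφ, add_assoc] at this
      linear_combination this
  · have := congrArg (φ 0) k1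
    simp [hφ, add_assoc] at this
    linear_combination this
  · have := congrArg (φ (n + 1)) (k2 n)
    simp [hφ, add_assoc] at this
    linear_combination this
  · have := congrArg (φ n) (k2 n)
    simp [hφ, add_assoc] at this
    linear_combination this
  · have := congrArg (φ n) (k2 (n + 1))
    simp [hφ, add_assoc] at this
    linear_combination this

/-! ### Chebyshev-type recurrences and elimination -/

/-- The solution of `x (n + 2) = t * x (n + 1) - x n` with given initial values. -/
def chebSeq (t x₀ x₁ : ℂ) : ℕ → ℂ
  | 0 => x₀
  | 1 => x₁
  | n + 2 => t * chebSeq t x₀ x₁ (n + 1) - chebSeq t x₀ x₁ n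

theorem chebSeq_add_two (t x₀ x₁ : ℂ) (n : ℕ) :
    chebSeq t x₀ x₁ (n + 2) = t * chebSeq t x₀ x₁ (n + 1) - chebSeq t x₀ x₁ n := rfl

/-- An addition formula: shifting one unit from `m` to `k` leaves the left side unchanged. It
produces the doubled indices. -/
theorem chebSeq_succ_mul_sub (t x₀ x₁ : ℂ) (k m : ℕ) :
    chebSeq t x₀ x₁ (k + 1) * chebSeq t 0 1 (m + 1) - chebSeq t x₀ x₁ k * chebSeq t 0 1 m
      = chebSeq t x₀ x₁ (k + m + 1) := by
  induction m generalizing k with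
  | zero => simp [chebSeq]
  | succ m ih =>
    have := ih (k + 1)
    rw [chebSeq_add_two] at this
    rw [chebSeq_add_two, show k + (m + 1) + 1 = k + 1 + m + 1 by ring]
    linear_combination this

theorem exists_chebSeq_eq {p : ℂ} (hp : p ≠ 0) (hp2 : p ^ 2 ≠ 1) (x₀ x₁ : ℂ) :
    ∃ a b : ℂ, ∀ n, chebSeq (p + p⁻¹) x₀ x₁ n = a * p ^ n + b * (p ^ n)⁻¹ := by
  have h : p ^ 2 - 1 ≠ 0 := sub_ne_zero.2 hp2
  refine ⟨(p * x₁ - x₀) / (p ^ 2 - 1), (p ^ 2 * x₀ - p * x₁) / (p ^ 2 - 1), fun n => ?_⟩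
  induction n using Nat.twoStepInduction with
  | zero =>
    simp only [chebSeq]
    field_simp
    ring
  | one =>
    simp only [chebSeq]
    field_simp
    ring
  | more n h1 h2 =>
    rw [chebSeq_add_two, h1, h2]
    field_simp
    ring

/-- The Riccati recurrence `t n * (τ - t (n + 1)) = 1` is linearised by `t = s (n + 1) / s n`. -/
theorem linearise_riccati {τ : ℂ} {s t : ℕ → ℂ} (hs : ∀ n, s (n + 2) = τ * s (n + 1) - s n)
    (h0 : s 0 ≠ 0) (h1 : s 1 = t 0 * s 0) (h : ∀ n, t n * (τ - t (n + 1)) = 1) (n : ℕ) :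
    s n ≠ 0 ∧ s (n + 1) = t n * s n := by
  induction n with
  | zero => exact ⟨h0, h1⟩
  | succ n ih =>
    refine ⟨ih.2 ▸ mul_ne_zero (left_ne_zero_of_mul_eq_one (h n)) ih.1, ?_⟩
    rw [hs, ih.2]
    linear_combination s n * h n

/-- Elimination of `b` from the two linear relations between `B` and `b`. -/
theorem elimination_linear (τ x₀ x₁ : ℂ) {B b : ℕ → ℂ} (n : ℕ)
    (h1 : chebSeq τ 0 1 (n + 3) * b (n + 1) - chebSeq τ 0 1 (n + 1) * b n
      = chebSeq τ 0 1 (n + 2) * B (n + 2) - chebSeq τ 0 1 n * B (n + 1))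
    (h2 : chebSeq τ 0 1 (n + 4) * b (n + 2) - chebSeq τ 0 1 (n + 2) * b (n + 1)
      = chebSeq τ 0 1 (n + 3) * B (n + 3) - chebSeq τ 0 1 (n + 1) * B (n + 2))
    (h3 : chebSeq τ x₀ x₁ (n + 4) * B (n + 2) - chebSeq τ x₀ x₁ (n + 2) * B (n + 1)
      = chebSeq τ x₀ x₁ (n + 3) * b (n + 1) - chebSeq τ x₀ x₁ (n + 1) * b n)
    (h4 : chebSeq τ x₀ x₁ (n + 5) * B (n + 3) - chebSeq τ x₀ x₁ (n + 3) * B (n + 2)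
      = chebSeq τ x₀ x₁ (n + 4) * b (n + 2) - chebSeq τ x₀ x₁ (n + 2) * b (n + 1)) :
    chebSeq τ x₀ x₁ (2 * (n + 4)) * B (n + 3)
      - (chebSeq τ x₀ x₁ (2 * (n + 3)) + chebSeq τ x₀ x₁ (2 * (n + 2))) * B (n + 2)
      + chebSeq τ x₀ x₁ (2 * (n + 1)) * B (n + 1) = 0 := by
  have e4 := chebSeq_succ_mul_sub τ x₀ x₁ (n + 4) (n + 3)
  have e3 := chebSeq_succ_mul_sub τ x₀ x₁ (n + 3) (n + 2)
  have e2 := chebSeq_succ_mul_sub τ x₀ x₁ (n + 2) (n + 1)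
  have e1 := chebSeq_succ_mul_sub τ x₀ x₁ (n + 1) n
  rw [show n + 4 + (n + 3) + 1 = 2 * (n + 4) by ring] at e4
  rw [show n + 3 + (n + 2) + 1 = 2 * (n + 3) by ring] at e3
  rw [show n + 2 + (n + 1) + 1 = 2 * (n + 2) by ring] at e2
  rw [show n + 1 + n + 1 = 2 * (n + 1) by ring] at e1
  rw [← e1, ← e2, ← e3, ← e4]
  simp only [chebSeq_add_two] at *
  generalize chebSeq τ x₀ x₁ n = s0 at *
  generalize chebSeq τ x₀ x₁ (n + 1) = s1 at *
  generalize chebSeq τ 0 1 n = g0 at *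
  generalize chebSeq τ 0 1 (n + 1) = g1 at *
  -- The weights are the terms of index `n + 4` and `n + 1` of the two sequences; the coefficient of
  -- `b (n + 1)` cancels because their Casoratian is constant.
  linear_combination (τ * (τ * (τ * s1 - s0) - s1) - (τ * s1 - s0)) * h2
    + (τ * (τ * (τ * g1 - g0) - g1) - (τ * g1 - g0)) * h4 - s1 * h1 - g1 * h3

/-- The quadratic consequence of the two linear relations between `B`, `B'` and `b`, `b'`, where
`s₀, s₁` and `g₀, g₁` are consecutive terms of solutions of `x (n + 2) = τ x (n + 1) - x n`. -/
theorem elimination_quadratic {τ s₀ s₁ g₀ g₁ B B' b b' : ℂ}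
    (h1 : (τ * g₁ - g₀) * b - g₀ * b' = g₁ * B - (τ * g₀ - g₁) * B')
    (h2 : (τ * s₁ - s₀) * B - s₀ * B' = s₁ * b - (τ * s₀ - s₁) * b') :
    τ * ((τ * g₁ - g₀) * s₁ * (B ^ 2 - τ * B * b + b ^ 2)
        - g₀ * (τ * s₀ - s₁) * (B' ^ 2 - τ * B' * b' + b' ^ 2))
      = (s₁ * g₁ - s₀ * g₀) * (B ^ 2 - (τ ^ 2 - 2) * B * B' + B' ^ 2) := by
  linear_combination
    (τ / 2 * (s₁ * b + (τ * s₀ - s₁) * b' - (τ * s₁ - s₀) * B - s₀ * B')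
      - (τ * s₀ - s₁) * B + s₁ * B') * h1
    - (τ / 2 * ((τ * g₁ - g₀) * b + g₀ * b' - g₁ * B - (τ * g₀ - g₁) * B')
      + g₀ * B - (τ * g₁ - g₀) * B') * h2

/-! ### Solving the coefficient system -/

theorem relations_of_coeff_identities {τ : ℂ} {B c a b d : ℕ → ℂ} (hc : ∀ n, c (n + 1) ≠ 0)
    (ha0 : τ * a 0 = 1) (hb0 : τ * b 0 = B 1 + B 0) (ha : ∀ n, a (n + 1) * (τ - a n) = 1)
    (hb : ∀ n, B (n + 2) + B (n + 1) = τ * (b (n + 1) + B (n + 1) * a n)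
      - a n * (b (n + 1) + b n))
    (hd1 : c 2 + B 1 ^ 2 + c 1 = τ * (d 1 + B 1 * b 0) - a 0 * d 1 - b 0 ^ 2
      - ((τ / 2) ^ 2 - 1))
    (hd : ∀ n, c (n + 3) + B (n + 2) ^ 2 + c (n + 2)
      = τ * (d (n + 2) + B (n + 2) * b (n + 1) + c (n + 2) * a n)
        - a (n + 1) * d (n + 2) - b (n + 1) ^ 2 - d (n + 1) * a n - ((τ / 2) ^ 2 - 1))
    (hB : ∀ n, c (n + 2) * (B (n + 2) + B (n + 1)) = τ * (B (n + 2) * d (n + 1)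
      + c (n + 2) * b n) - d (n + 1) * (b (n + 1) + b n))
    (ht : ∀ n, c (n + 3) * c (n + 2) = τ * c (n + 3) * d (n + 1) - d (n + 2) * d (n + 1)) :
    ∃ x₀ x₁ : ℂ, chebSeq τ x₀ x₁ 2 ≠ 0 ∧
      (∀ n, chebSeq τ x₀ x₁ (2 * (n + 3)) * B (n + 2)
        - (chebSeq τ x₀ x₁ (2 * (n + 2)) + chebSeq τ x₀ x₁ (2 * (n + 1))) * B (n + 1)
        + chebSeq τ x₀ x₁ (2 * n) * B n = 0) ∧
      ∀ n, chebSeq τ x₀ x₁ (2 * (n + 2)) * (B (n + 2) ^ 2 - (τ ^ 2 - 2) * B (n + 2) * B (n + 1)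
          + B (n + 1) ^ 2)
        = (chebSeq τ x₀ x₁ (2 * (n + 3)) + chebSeq τ x₀ x₁ (2 * (n + 4))) * (c (n + 3) - 1 / 4)
          - τ ^ 2 * chebSeq τ x₀ x₁ (2 * (n + 2)) * (c (n + 2) - 1 / 4)
          + (chebSeq τ x₀ x₁ (2 * (n + 1)) + chebSeq τ x₀ x₁ (2 * n)) * (c (n + 1) - 1 / 4) := by
  -- The Riccati data fix the sequence from index 2 on; `x₀`, `x₁` come from running the recurrence
  -- backwards.
  obtain ⟨x₀, x₁, h2, h3⟩ : ∃ x₀ x₁ : ℂ, chebSeq τ x₀ x₁ 2 = 1 ∧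
      chebSeq τ x₀ x₁ 3 = d 1 / c 2 := by
    refine ⟨τ * (τ - d 1 / c 2) - 1, τ - d 1 / c 2, ?_, ?_⟩ <;> simp only [chebSeq] <;> ring
  refine ⟨x₀, x₁, h2 ▸ one_ne_zero, ?_⟩
  have hS : ∀ n, chebSeq τ x₀ x₁ (n + 2) ≠ 0 ∧
      d (n + 1) * chebSeq τ x₀ x₁ (n + 2) = chebSeq τ x₀ x₁ (n + 3) * c (n + 2) := fun n => by
    have := linearise_riccati (τ := τ) (s := fun n => chebSeq τ x₀ x₁ (n + 2))
      (t := fun n => d (n + 1) / c (n + 2)) (fun _ => rfl) (h2 ▸ one_ne_zero)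
      (h3.trans (by rw [h2, mul_one])) (fun n => by
        have c1 := hc (n + 1)
        have c2 := hc (n + 2)
        simp only [add_assoc, Nat.reduceAdd] at c1 c2 ⊢
        field_simp
        linear_combination -ht n) n
    refine ⟨this.1, ?_⟩
    have c1 := hc (n + 1)
    have e := this.2
    simp only [add_assoc, Nat.reduceAdd] at c1 e
    rw [e]
    field_simp
  have hg : ∀ n, chebSeq τ 0 1 (n + 1) ≠ 0 ∧
      a n * chebSeq τ 0 1 (n + 2) = chebSeq τ 0 1 (n + 1) := by
    intro n
    induction n with
    | zero => simpa [chebSeq, mul_comm] using ha0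
    | succ n ih =>
      have h : chebSeq τ 0 1 (n + 2) ≠ 0 := right_ne_zero_of_mul (ih.2 ▸ ih.1)
      refine ⟨h, ?_⟩
      rw [chebSeq_add_two]
      linear_combination chebSeq τ 0 1 (n + 2) * ha n + a (n + 1) * ih.2
  have E1 : ∀ n, chebSeq τ 0 1 (n + 3) * b (n + 1) - chebSeq τ 0 1 (n + 1) * b n
      = chebSeq τ 0 1 (n + 2) * B (n + 2) - chebSeq τ 0 1 n * B (n + 1) := fun n => by
    have := (hg n).2
    rw [chebSeq_add_two _ _ _ (n + 1)]
    rw [chebSeq_add_two] at this ⊢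
    linear_combination (b (n + 1) + b n - τ * B (n + 1)) * this
      - (τ * chebSeq τ 0 1 (n + 1) - chebSeq τ 0 1 n) * hb n
  have E3 : ∀ n, chebSeq τ x₀ x₁ (n + 4) * B (n + 2) - chebSeq τ x₀ x₁ (n + 2) * B (n + 1)
      = chebSeq τ x₀ x₁ (n + 3) * b (n + 1) - chebSeq τ x₀ x₁ (n + 1) * b n := fun n => by
    have := (hS n).2
    refine mul_left_cancel₀ (hc (n + 1)) ?_
    rw [chebSeq_add_two _ _ _ (n + 2)]
    rw [chebSeq_add_two _ _ _ (n + 1)] at this ⊢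
    linear_combination (b (n + 1) + b n - τ * B (n + 2)) * this - chebSeq τ x₀ x₁ (n + 2) * hB n
  set g := chebSeq τ 0 1 with hg_def
  set S := chebSeq τ x₀ x₁ with hS_def
  have I : ∀ k m, S (k + 1) * g (m + 1) - S k * g m = S (k + m + 1) :=
    chebSeq_succ_mul_sub τ x₀ x₁
  have rS : ∀ n, S (n + 2) = τ * S (n + 1) - S n := fun n => rfl
  have rg : ∀ n, g (n + 2) = τ * g (n + 1) - g n := fun n => rfl
  -- With the weight `c (n + 2) / (g (n + 2) * S (n + 2))`, the `c`, `d` terms of `hd` become a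
  -- difference of two terms of `S`.
  have hY : ∀ n, d (n + 1) * (τ - a n) - c (n + 2)
      = S (2 * n + 5) * (c (n + 2) / (g (n + 2) * S (n + 2))) := fun n => by
    have h1 := (hg (n + 1)).1
    have h2 := (hS n).1
    have i : S (n + 3) * g (n + 3) - S (n + 2) * g (n + 2) = S (2 * n + 5) :=
      (I (n + 2) (n + 2)).trans (congrArg S (by ring))
    rw [eq_div_of_mul_eq h2 (hS n).2, eq_div_of_mul_eq h1 (hg n).2, ← i, rg (n + 1)]
    simp only [add_assoc, Nat.reduceAdd] at h1 ⊢
    field_simp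
  have hY' : ∀ n, d (n + 1) * a n + c (n + 2) * (1 - τ * a n)
      = S (2 * n + 3) * (c (n + 2) / (g (n + 2) * S (n + 2))) := fun n => by
    have h1 := (hg (n + 1)).1
    have h2 := (hS n).1
    have i : S (n + 3) * g (n + 1) - S (n + 2) * g n = S (2 * n + 3) :=
      (I (n + 2) n).trans (congrArg S (by ring))
    rw [eq_div_of_mul_eq h2 (hS n).2, eq_div_of_mul_eq h1 (hg n).2, ← i]
    simp only [add_assoc, Nat.reduceAdd] at h1 ⊢
    field_simp
    rw [rg]
    ring
  have E2 : ∀ n, B (n + 2) ^ 2 - τ * B (n + 2) * b (n + 1) + b (n + 1) ^ 2 + ((τ / 2) ^ 2 - 1)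
      = S (2 * n + 7) * (c (n + 3) / (g (n + 3) * S (n + 3)))
        - S (2 * n + 3) * (c (n + 2) / (g (n + 2) * S (n + 2))) := fun n => by
    have h := hY (n + 1)
    simp only [mul_add, mul_one, add_assoc, Nat.reduceAdd] at h
    linear_combination hd n + h - hY' n
  -- This is `E2` one index lower, multiplied out because `S 1` may vanish; the initial case is
  -- `hd1`.
  have E2' : ∀ n, g (n + 1) * S (n + 1)
        * (B (n + 1) ^ 2 - τ * B (n + 1) * b n + b n ^ 2 + ((τ / 2) ^ 2 - 1))
      = g (n + 1) * S (n + 1) * S (2 * n + 5) * (c (n + 2) / (g (n + 2) * S (n + 2)))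
        - S (2 * n + 1) * c (n + 1) := by
    rintro (_ | n)
    · rw [show g (0 + 1) = 1 from rfl]
      linear_combination S 1 * hd1 + S 1 * hY 0
    · have h := mul_div_cancel₀ (c (n + 2)) (mul_ne_zero (hg (n + 1)).1 (hS n).1)
      simp only [mul_add, mul_one, add_assoc, Nat.reduceAdd] at h ⊢
      linear_combination g (n + 2) * S (n + 2) * E2 n - S (2 * n + 3) * h
  constructor
  · rintro (_ | n)
    -- The initial case uses `hb0`, the only relation containing `B 0`.
    · have h1 := E1 0
      have h3 := E3 0
      simp only [hg_def, hS_def, mul_zero, zero_add, Nat.reduceMul, chebSeq]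
        at h1 h3 ⊢
      linear_combination (τ * (τ * x₁ - x₀) - x₁) * h1 + (τ ^ 2 - 1) * h3 - x₀ * hb0
    · exact elimination_linear τ x₀ x₁ n (E1 n) (E1 (n + 1)) (E3 n) (E3 (n + 1))
  · intro n
    have hq := elimination_quadratic (τ := τ) (s₀ := S (n + 2)) (s₁ := S (n + 3))
      (g₀ := g (n + 1)) (g₁ := g (n + 2)) (B := B (n + 2)) (B' := B (n + 1)) (b := b (n + 1))
      (b' := b n)
      (by linear_combination E1 n - b (n + 1) * rg (n + 1) - B (n + 1) * rg n)
      (by linear_combination E3 n - B (n + 2) * rS (n + 2) - b n * rS (n + 1))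
    have h := mul_div_cancel₀ (c (n + 2)) (mul_ne_zero (hg (n + 1)).1 (hS n).1)
    have i0 : S (n + 2) * g (n + 2) - S (n + 1) * g (n + 1) = S (2 * n + 3) :=
      (I (n + 1) (n + 1)).trans (congrArg S (by ring))
    have i1 : S (n + 3) * g (n + 3) - S (n + 2) * g (n + 2) = S (2 * n + 5) :=
      (I (n + 2) (n + 2)).trans (congrArg S (by ring))
    have i2 : S (n + 3) * g (n + 2) - S (n + 2) * g (n + 1) = S (2 * n + 4) :=
      (I (n + 2) (n + 1)).trans (congrArg S (by ring))
    have h2 := E2 n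
    have h2' := E2' n
    have h3 := mul_div_cancel₀ (c (n + 3)) (mul_ne_zero (hg (n + 2)).1 (hS (n + 1)).1)
    rw [i2, ← rg (n + 1), show τ * S (n + 2) - S (n + 3) = S (n + 1) by
      linear_combination -rS (n + 1)] at hq
    simp only [mul_add, Nat.reduceMul, add_assoc, Nat.reduceAdd] at h3 hq ⊢
    generalize c (n + 2) / (g (n + 2) * S (n + 2)) = Y at *
    generalize c (n + 3) / (g (n + 3) * S (n + 3)) = Z at *
    have e8 : S (2 * n + 8) = τ * S (2 * n + 7) - S (2 * n + 6) := rS _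
    have e7 : S (2 * n + 7) = τ * S (2 * n + 6) - S (2 * n + 5) := rS _
    have e6 : S (2 * n + 6) = τ * S (2 * n + 5) - S (2 * n + 4) := rS _
    have e5 : S (2 * n + 5) = τ * S (2 * n + 4) - S (2 * n + 3) := rS _
    have e4 : S (2 * n + 4) = τ * S (2 * n + 3) - S (2 * n + 2) := rS _
    have e3 : S (2 * n + 3) = τ * S (2 * n + 2) - S (2 * n + 1) := rS _
    have e2 : S (2 * n + 2) = τ * S (2 * n + 1) - S (2 * n) := rS _
    simp only [e8, e7, e6, e5, e4, e3, e2] at h2 h2' hq i0 i1 ⊢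
    generalize S (2 * n) = u at *
    generalize S (2 * n + 1) = w at *
    -- `E2` and `E2'` replace the quadratic forms in `hq` by `c`-terms; sums of neighbouring even
    -- terms of `S` are `τ` times the odd term between them.
    linear_combination -hq + τ * g (n + 3) * S (n + 3) * h2 - τ * h2'
      + τ * (τ * (τ * (τ * (τ * (τ * (τ * w - u) - w) - (τ * w - u))
        - (τ * (τ * w - u) - w)) - (τ * (τ * (τ * w - u) - w) - (τ * w - u)))
        - (τ * (τ * (τ * (τ * w - u) - w) - (τ * w - u)) - (τ * (τ * w - u) - w))) * h3
      - (τ * (τ * (τ * w - u) - w) * Y + τ * ((τ / 2) ^ 2 - 1)) * i1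
      - (τ * ((τ / 2) ^ 2 - 1) - τ * (τ * (τ * (τ * (τ * w - u) - w) - (τ * w - u))
        - (τ * (τ * w - u) - w)) * Y) * i0
      - τ ^ 2 * (τ * (τ * (τ * w - u) - w) - (τ * w - u)) * h

end AskeyWilson

/-! ### Conclusion -/

theorem theorem1 (q : ℝ) (hq0 : 0 < q) (hq1 : q < 1)
    (P : ℕ → Polynomial ℂ) (u : Module.Dual ℂ (Polynomial ℂ))
    (hP : AskeyWilson.IsMonicOPS P u)
    (B C : ℕ → ℂ) (hTTRR : AskeyWilson.IsTTRR P B C)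
    (hcl : AskeyWilson.IsClassical q P) :
    ∃ (a b : ℂ) (r : ℕ → ℂ),
      ‖a‖ + ‖b‖ ≠ 0 ∧ r ≠ 0 ∧
      (∀ n : ℕ, r n = a * (q : ℂ) ^ n + b * ((q : ℂ) ^ n)⁻¹) ∧
      (∀ n : ℕ, r (n + 3) * B (n + 2) - (r (n + 2) + r (n + 1)) * B (n + 1) + r n * B n = 0) ∧
      (∀ n : ℕ, 2 ≤ n →
        r n * (B n - (q : ℂ) * B (n - 1)) * (B n - (q : ℂ)⁻¹ * B (n - 1)) =
          (r (n + 1) + r (n + 2)) * (C (n + 1) - 1 / 4)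
            - 4 * (AskeyWilson.alpha q) ^ 2 * r n * (C n - 1 / 4)
            + (r (n - 1) + r (n - 2)) * (C (n - 1) - 1 / 4)) := by
  obtain ⟨v, hv⟩ := hcl
  obtain ⟨a, b, d, ha0, hb0, ha, hb, hd1, hd, hB, ht⟩ :=
    AskeyWilson.coeff_identities hq0 hq1 (hP.degree_eq 0) hTTRR hv
  have hα : (2 * AskeyWilson.alpha q / 2) ^ 2 = AskeyWilson.alpha q ^ 2 := by ring
  obtain ⟨x₀, x₁, hne, hlin, hquad⟩ := AskeyWilson.relations_of_coeff_identities
    (hP.recurrence_coeff_ne_zero hTTRR) ha0 hb0 ha hb (hα ▸ hd1) (hα ▸ hd) hB ht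
  have hp := AskeyWilson.sqrtq_ne_zero hq0
  have hpq := AskeyWilson.sqrtq_sq hq0
  have hq : (q : ℂ) ≠ 0 := by exact_mod_cast hq0.ne'
  have hτ : 2 * AskeyWilson.alpha q = AskeyWilson.sqrtq q + (AskeyWilson.sqrtq q)⁻¹ := by
    unfold AskeyWilson.alpha
    ring
  obtain ⟨s₁, s₂, hr⟩ := AskeyWilson.exists_chebSeq_eq hp
    (by rw [hpq]; exact_mod_cast hq1.ne) x₀ x₁
  rw [← hτ] at hr
  have hne' : AskeyWilson.chebSeq (2 * AskeyWilson.alpha q) x₀ x₁ (2 * 1) ≠ 0 := hne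
  refine ⟨s₁, s₂, fun n => AskeyWilson.chebSeq (2 * AskeyWilson.alpha q) x₀ x₁ (2 * n), ?_,
    fun h => hne' (congrFun h 1), fun n => ?_, hlin, fun n hn => ?_⟩
  · intro h
    have h1 : s₁ = 0 := norm_eq_zero.1 (by linarith [norm_nonneg s₁, norm_nonneg s₂])
    have h2 : s₂ = 0 := norm_eq_zero.1 (by linarith [norm_nonneg s₁, norm_nonneg s₂])
    exact hne (by rw [hr, h1, h2]; ring)
  · exact (hr _).trans (by rw [pow_mul, hpq])
  · obtain ⟨n, rfl⟩ := Nat.exists_eq_add_of_le' hn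
    -- This makes the quadratic form in `B (n + 2)`, `B (n + 1)` split into the two required
    -- factors.
    have hsum : (2 * AskeyWilson.alpha q) ^ 2 - 2 = (q : ℂ) + (q : ℂ)⁻¹ := by
      rw [hτ, ← hpq]
      field_simp
      ring
    have h := hquad n
    rw [hsum] at h
    simp only [Nat.add_sub_cancel, show n + 2 - 1 = n + 1 from rfl]
    linear_combination h
      + AskeyWilson.chebSeq (2 * AskeyWilson.alpha q) x₀ x₁ (2 * (n + 2)) * B (n + 1) ^ 2
        * mul_inv_cancel₀ hq
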